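/- Let $k\ge 1$ be an integer and let $X_1,\dots,X_n$ be independent, identically distributed, non-negative random variables with a continuous distribution, i.e. one without point masses. In the IID Top-$1$-of-$k$ problem the values $X_1,\dots,X_n$ are revealed one by one; a gambler irrevocably accepts or rejects each value on arrival, may accept at most $k$ of them, and receives as reward $\mathsf{ALG}$ the largest accepted value ($0$ if none is accepted). Consider the following algorithm: choose an initial threshold $\tau$ with $$\sum_{i=1}^n \mathbb P(X_i\ge \tau)=e^{\sqrt k};$$ whenever the current value $X_i$ satisfies $X_i>\tau$, accept $X_i$ and reset $\tau\leftarrow X_i$; stop once $k$ values have been accepted or all values have been seen. If $n\ge e^{\sqrt k}$, an initial threshold $\tau\ge 0$ as required exists. For every $n$ and every such choice of the initial threshold, the algorithm has competitive ratio at least $1-k^{-k/5}$: $$\mathbb E[\mathsf{ALG}]\ \ge\ \bigl(1-k^{-k/5}\bigr)\,\mathbb E\Bigl[\max_{1\le i\le n}X_i\Bigr]$$ (as an inequality in $[0,\infty]$). The loss $k^{-k/5}$ is super-exponentially small in $k$: for every real $C$, $k^{-k/5}=o(e^{-Ck})$ as $k\to\infty$. -/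

import Mathlib

open MeasureTheory ProbabilityTheory

/-- The values accepted, in order, by the online rule with `r` remaining slots and current
threshold `τ` on the stream of values `l`: the current value is accepted iff it is strictly above
the current threshold, which is then raised to the accepted value; the rule stops when no slot is
left or the stream is exhausted. -/
noncomputable def acceptedValues : ℕ → ℝ → List ℝ → List ℝ
  | 0, _, _ => []
  | _ + 1, _, [] => []
  | r + 1, τ, x :: xs =>
      if τ < x then x :: acceptedValues r x xs else acceptedValues (r + 1) τ xs

/-- The reward in the Top-1-of-`k` problem of the rising threshold rule with initial threshold `τ`
on the values `v 0, v 1, …, v (n - 1)`, presented in this order: the highest accepted value,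
and `0` if nothing is accepted. (Values are nonnegative.) -/
noncomputable def risingThresholdReward {n : ℕ} (k : ℕ) (τ : ℝ) (v : Fin n → ℝ) : ℝ :=
  (acceptedValues k τ (List.ofFn v)).foldr max 0

/-- `X 0, …, X (n - 1)` is an instance of the IID problem on the probability space `(Ω, P)`:
nonnegative, independent, identically distributed random variables whose common law is
continuous (it has no point masses). -/
structure IsIIDInstance {Ω : Type*} [MeasurableSpace Ω] (P : Measure Ω) {n : ℕ}
    (X : Fin n → Ω → ℝ) : Prop where
  measurable : ∀ i, Measurable (X i)
  nonneg : ∀ i, ∀ᵐ ω ∂P, 0 ≤ X i ω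
  indep : iIndepFun X P
  identDistrib : ∀ i j, IdentDistrib (X i) (X j) P P
  continuous : ∀ i, ∀ x : ℝ, P {ω | X i ω = x} = 0

/-! For a level `t ≥ τ`, the rule can miss `t` although some value exceeds it only if it spends all
`k` slots on records in `(τ, t]` beforehand. If `R` counts these records, an exponential moment with
base `r + 1` controls this event: `((r + 1) ^ k - 1) P(miss) + P(max > t) ≤ E[(r + 1) ^ R; max >
t]`. Conditioning on the first value, and using the cdf to pass to uniform values, shows by
induction that `recordEnvelope` bounds this quantity (`missProb_le_recordEnvelope`); the analytic
core is `rpow_growth_step`.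

Chebyshev's sum inequality factors `P(max > t)` out of the envelope, leaving a constant that depends
only on `r` and the expected count `q` (`recordEnvelope_le`). Thus `P(miss) ≤ δ P(max > t)` with `δ`
independent of `t`. Levels below `τ` cost a further `exp (-q)`, a bound on the probability that
nothing exceeds `τ`. The tail comparison then holds at every level, and integrating over levels
gives the ratio. With `q = exp √k`, the choice `r + 1 = √k` (or `2` when `k` is `2` or `3`) makes
`exp (-q) + δ` at most `k ^ (-k / 5)`. -/

/-! ### Growth inequality for powers -/

theorem integral_one_add_mul_rpow (b u : ℝ) {r : ℝ} (hr : 1 ≤ r) :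
    (r + 1) * b * ∫ v in (0 : ℝ)..u, (1 + b * v) ^ r = (1 + b * u) ^ (r + 1) - 1 := by
  have hcont : Continuous fun v : ℝ => (1 + b * v) ^ r :=
    (by fun_prop : Continuous fun v : ℝ => 1 + b * v).rpow_const fun _ => Or.inr (by linarith)
  have h := intervalIntegral.integral_eq_sub_of_hasDerivAt (a := 0) (b := u)
    (f := fun v : ℝ => (1 + b * v) ^ (r + 1)) (f' := fun v => (r + 1) * b * (1 + b * v) ^ r)
    (fun v _ => by
      have h1 : HasDerivAt (fun v : ℝ => 1 + b * v) b v := by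
        simpa using ((hasDerivAt_id v).const_mul b).const_add 1
      refine (h1.rpow_const (p := r + 1) (Or.inr (by linarith))).congr_deriv ?_
      rw [add_sub_cancel_right]; ring)
    ((hcont.const_mul _).intervalIntegrable _ _)
  rw [intervalIntegral.integral_const_mul] at h
  simpa using h

/-- Multiplied by `m` and with the integral evaluated, the left side collapses to `(m + 1) (1 + m u)
^ r - 1`. Convexity of the power finishes, as `1 + m u` averages `1 + (m + 1) u` and `1` with
weights `m : 1`. The case `m = 0` is Bernoulli's inequality. -/
theorem rpow_growth_step {r u : ℝ} (hr : 1 ≤ r) (hu : 0 ≤ u) (m : ℕ) :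
    (1 - u) * (1 + m * u) ^ r + (r + 1) * ∫ v in (0 : ℝ)..u, (1 + m * v) ^ r
      ≤ (1 + (m + 1) * u) ^ r := by
  rcases Nat.eq_zero_or_pos m with rfl | hm
  · have := one_add_mul_self_le_rpow_one_add (s := u) (by linarith) hr
    simp only [Nat.cast_zero, zero_mul, add_zero, Real.one_rpow, zero_add, one_mul,
      intervalIntegral.integral_const, sub_zero, smul_eq_mul, mul_one]
    linarith
  · have hm' : (0 : ℝ) < m := by exact_mod_cast hm
    have hI := integral_one_add_mul_rpow m u hr
    have hA : 0 < 1 + m * u := by positivity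
    have hpow : (1 + m * u) ^ (r + 1) = (1 + m * u) ^ r * (1 + m * u) := by
      rw [Real.rpow_add hA, Real.rpow_one]
    rw [hpow] at hI
    have hx : 1 + ((m : ℝ) + 1) * u ∈ Set.Ici (0 : ℝ) := by simp only [Set.mem_Ici]; positivity
    have hconv := (convexOn_rpow hr).2 hx (Set.mem_Ici.2 zero_le_one)
      (by positivity : 0 ≤ (m : ℝ) / (m + 1)) (by positivity : 0 ≤ 1 / ((m : ℝ) + 1))
      (by field_simp)
    simp only [smul_eq_mul, Real.one_rpow, mul_one] at hconv
    have hmid : (m : ℝ) / (m + 1) * (1 + (m + 1) * u) + 1 / (m + 1) = 1 + m * u := by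
      field_simp; ring
    rw [hmid] at hconv
    have hconv' : (m + 1) * (1 + m * u) ^ r ≤ m * (1 + (m + 1) * u) ^ r + 1 := by
      calc (m + 1) * (1 + m * u) ^ r
          ≤ (m + 1) * (m / (m + 1) * (1 + (m + 1) * u) ^ r + 1 / (m + 1)) := by gcongr
        _ = _ := by field_simp
    refine le_of_mul_le_mul_left ?_ hm'
    nlinarith

theorem rpow_growth_step_scaled {r u c : ℝ} (hr : 1 ≤ r) (hu : 0 ≤ u) (huc : u ≤ c) (m : ℕ) :
    (c - u) * (1 + m * (u / c)) ^ r + (r + 1) * ∫ v in (0 : ℝ)..u, (1 + m * (v / c)) ^ r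
      ≤ c * (1 + (m + 1) * (u / c)) ^ r := by
  rcases (hu.trans huc).eq_or_lt with rfl | hc
  · obtain rfl : u = 0 := le_antisymm huc hu
    simp
  · rw [intervalIntegral.integral_comp_div (fun v => (1 + m * v) ^ r) hc.ne']
    have h := mul_le_mul_of_nonneg_left (rpow_growth_step hr (div_nonneg hu hc.le) m) hc.le
    rw [zero_div, smul_eq_mul]
    refine le_trans (le_of_eq ?_) h
    have : c - u = c * (1 - u / c) := by field_simp
    rw [this]; ring

/-! ### The record envelope -/

/-- An upper bound for the expectation of `(r + 1) ^ R` on the event that one of `n` uniform values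
exceeds `c`, where `R` is the number of running maxima in `(c - u, c]` before that value. -/
noncomputable def recordEnvelope (r c : ℝ) (n : ℕ) (u : ℝ) : ℝ :=
  ∑ m ∈ Finset.range n, (1 - c) * c ^ m * (1 + m * (u / c)) ^ r

theorem continuous_recordEnvelope {r : ℝ} (hr : 1 ≤ r) (c : ℝ) (n : ℕ) :
    Continuous (recordEnvelope r c n) := by
  unfold recordEnvelope
  refine continuous_finsetSum _ fun m _ => continuous_const.mul ?_
  exact (by fun_prop : Continuous fun u : ℝ => 1 + m * (u / c)).rpow_const
    fun _ => Or.inr (by linarith)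

theorem sum_one_sub_mul_pow (c : ℝ) (n : ℕ) :
    ∑ m ∈ Finset.range n, (1 - c) * c ^ m = 1 - c ^ n := by
  rw [← Finset.mul_sum, mul_neg_geom_sum]

theorem one_sub_pow_le_recordEnvelope {r c u : ℝ} (hr : 1 ≤ r) (hc0 : 0 ≤ c) (hc : c ≤ 1)
    (hu : 0 ≤ u) (n : ℕ) : 1 - c ^ n ≤ recordEnvelope r c n u := by
  rw [← sum_one_sub_mul_pow]
  refine Finset.sum_le_sum fun m _ => le_mul_of_one_le_right ?_ ?_
  · exact mul_nonneg (by linarith) (by positivity)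
  · exact Real.one_le_rpow (by simp only [le_add_iff_nonneg_right]; positivity) (by linarith)

/-- The left side conditions on the first value: above `c`, at most `c - u` (ignored), or a new
record, which contributes a factor `r + 1` and shrinks the window to `v`. -/
theorem recordEnvelope_step {r c u : ℝ} (hr : 1 ≤ r) (hc : c ≤ 1) (hu : 0 ≤ u)
    (huc : u ≤ c) (n : ℕ) :
    (1 - c) + (c - u) * recordEnvelope r c n u + (r + 1) * ∫ v in (0 : ℝ)..u, recordEnvelope r c n v
      ≤ recordEnvelope r c (n + 1) u := by
  have hint : ∫ v in (0 : ℝ)..u, recordEnvelope r c n v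
      = ∑ m ∈ Finset.range n, (1 - c) * c ^ m * ∫ v in (0 : ℝ)..u, (1 + m * (v / c)) ^ r := by
    unfold recordEnvelope
    rw [intervalIntegral.integral_finsetSum]
    · simp only [intervalIntegral.integral_const_mul]
    · intro m _
      refine Continuous.intervalIntegrable (continuous_const.mul ?_) _ _
      exact (by fun_prop : Continuous fun u : ℝ => 1 + m * (u / c)).rpow_const
        fun _ => Or.inr (by linarith)
  -- The term `m = 0` on the right is exactly `1 - c`; term `m + 1` dominates the contributions of
  -- term `m` on the left.
  rw [hint, recordEnvelope, recordEnvelope, Finset.sum_range_succ', Finset.mul_sum, Finset.mul_sum]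
  simp only [pow_zero, mul_one, Nat.cast_zero, zero_mul, add_zero, Real.one_rpow]
  rw [add_assoc, ← Finset.sum_add_distrib, add_comm]
  gcongr with m _
  have h := mul_le_mul_of_nonneg_left (rpow_growth_step_scaled hr hu huc m)
    (mul_nonneg (by linarith : 0 ≤ 1 - c) (pow_nonneg (hu.trans huc) m))
  push_cast
  rw [pow_succ]
  linarith

/-- A left Riemann sum of an increasing function: Bernoulli bounds each term by an increment of `(1
+ m p) ^ z`, and the increments telescope. -/
theorem sum_one_add_mul_rpow_le {z p : ℝ} (hz : 1 ≤ z) (hp : 0 ≤ p) (n : ℕ) :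
    z * p * ∑ m ∈ Finset.range n, (1 + m * p) ^ (z - 1) ≤ (1 + n * p) ^ z - 1 := by
  induction n with
  | zero => simp
  | succ n ih =>
    rw [Finset.sum_range_succ, mul_add]
    have hA : 0 < 1 + n * p := by positivity
    have hb := one_add_mul_self_le_rpow_one_add (s := p / (1 + n * p))
      (le_trans (by norm_num) (div_nonneg hp hA.le)) hz
    have h2 : (1 + (n + 1 : ℕ) * p) ^ z = (1 + n * p) ^ z * (1 + p / (1 + n * p)) ^ z := by
      rw [← Real.mul_rpow hA.le (by positivity)]
      congr 1
      push_cast; field_simp; ring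
    have h3 : (1 + n * p) ^ z = (1 + n * p) ^ (z - 1) * (1 + n * p) := by
      rw [Real.rpow_sub_one hA.ne']; field_simp
    have h4 : (1 + n * p) ^ z * (z * (p / (1 + n * p))) = z * p * (1 + n * p) ^ (z - 1) := by
      rw [h3]; field_simp
    have := mul_le_mul_of_nonneg_left hb (Real.rpow_nonneg hA.le z)
    rw [h2]
    linarith

/-- Chebyshev's sum inequality: the geometric weights decrease in `m` while the powers increase. -/
theorem card_mul_recordEnvelope_le {r c u p : ℝ} (hr : 1 ≤ r) (hc0 : 0 ≤ c) (hc : c ≤ 1)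
    (hu : 0 ≤ u) (hup : u / c ≤ p) (n : ℕ) :
    n * recordEnvelope r c n u ≤ (1 - c ^ n) * ∑ m ∈ Finset.range n, (1 + m * p) ^ r := by
  have hp : 0 ≤ p := le_trans (by positivity) hup
  have hanti : AntivaryOn (fun m : ℕ => (1 - c) * c ^ m) (fun m : ℕ => (1 + m * p) ^ r)
      (Finset.range n) := by
    refine Antivary.antivaryOn (Antitone.antivary ?_ ?_) _
    · intro a b hab
      exact mul_le_mul_of_nonneg_left (pow_le_pow_of_le_one hc0 hc hab) (by linarith)
    · intro a b hab
      dsimp only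
      gcongr
  have h := hanti.card_mul_sum_le_sum_mul_sum
  rw [Finset.card_range, sum_one_sub_mul_pow] at h
  refine le_trans ?_ h
  unfold recordEnvelope
  gcongr with m _

theorem recordEnvelope_le {r c u p : ℝ} (hr : 1 ≤ r) (hc0 : 0 ≤ c) (hc : c ≤ 1)
    (hu : 0 ≤ u) (hup : u / c ≤ p) {n : ℕ} (hq : 0 < n * p) :
    recordEnvelope r c n u
      ≤ (1 - c ^ n) * (((1 + n * p) ^ (r + 1) - 1) / ((r + 1) * (n * p))) := by
  have hp : 0 ≤ p := le_trans (by positivity) hup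
  have h1 := card_mul_recordEnvelope_le hr hc0 hc hu hup n
  have h2 := sum_one_add_mul_rpow_le (z := r + 1) (by linarith) hp n
  rw [add_sub_cancel_right] at h2
  rw [← mul_div_assoc, le_div_iff₀ (by positivity)]
  have hc' : 0 ≤ 1 - c ^ n := by linarith [pow_le_one₀ (n := n) hc0 hc]
  calc recordEnvelope r c n u * ((r + 1) * (n * p))
      = (r + 1) * p * (n * recordEnvelope r c n u) := by ring
    _ ≤ (r + 1) * p * ((1 - c ^ n) * ∑ m ∈ Finset.range n, (1 + m * p) ^ r) := by gcongr
    _ = (1 - c ^ n) * ((r + 1) * p * ∑ m ∈ Finset.range n, (1 + m * p) ^ r) := by ring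
    _ ≤ _ := by gcongr

/-! ### Continuous laws and the probability integral transform -/

theorem continuous_cdf (μ : Measure ℝ) [IsProbabilityMeasure μ] [NullSingletonClass μ] :
    Continuous (cdf μ) := by
  refine continuous_iff_continuousAt.2 fun x => ?_
  rw [(monotone_cdf μ).continuousAt_iff_leftLim_eq_rightLim, StieltjesFunction.rightLim_eq]
  have h := (cdf μ).measure_singleton x
  rw [measure_cdf, measure_singleton, eq_comm, ENNReal.ofReal_eq_zero] at h
  exact le_antisymm ((monotone_cdf μ).leftLim_le le_rfl) (by linarith)

theorem measure_Ioc_eq_cdf_sub (μ : Measure ℝ) [IsProbabilityMeasure μ] (a b : ℝ) :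
    μ (Set.Ioc a b) = ENNReal.ofReal (cdf μ b - cdf μ a) := by
  conv_lhs => rw [← measure_cdf μ]
  exact (cdf μ).measure_Ioc a b

theorem map_cdf_restrict_Ioc (μ : Measure ℝ) [IsProbabilityMeasure μ] [NullSingletonClass μ] {a b : ℝ}
    (hab : a ≤ b) :
    (μ.restrict (Set.Ioc a b)).map (cdf μ) = volume.restrict (Set.Ioc (cdf μ a) (cdf μ b)) := by
  have hcont := continuous_cdf μ
  have hmono := monotone_cdf μ
  have hF : Measurable (cdf μ) := hmono.measurable
  refine Measure.ext_of_Iic _ _ fun s => ?_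
  rw [Measure.map_apply hF measurableSet_Iic, Measure.restrict_apply (hF measurableSet_Iic),
    Measure.restrict_apply measurableSet_Iic]
  have hvol : Set.Iic s ∩ Set.Ioc (cdf μ a) (cdf μ b) = Set.Ioc (cdf μ a) (min s (cdf μ b)) := by
    ext x; simp only [Set.mem_inter_iff, Set.mem_Iic, Set.mem_Ioc, le_min_iff]; tauto
  rw [hvol, Real.volume_Ioc]
  rcases lt_or_ge s (cdf μ a) with hs | hs
  · have hempty : cdf μ ⁻¹' Set.Iic s ∩ Set.Ioc a b = ∅ := by
      ext x
      simp only [Set.mem_inter_iff, Set.mem_preimage, Set.mem_Iic, Set.mem_Ioc,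
        Set.mem_empty_iff_false, iff_false, not_and]
      exact fun h1 h2 => absurd (hmono h2.le) (by linarith)
    rw [hempty, measure_empty, ENNReal.ofReal_of_nonpos]
    linarith [min_le_left s (cdf μ b)]
  -- The cdf may have flat pieces, so `y` is taken as the last point of `[a, b]` where it is at most
  -- `s`; the intermediate value theorem gives its value there.
  · obtain ⟨y, ⟨hyK, hyub⟩⟩ := (isCompact_Icc.inter_right
      (isClosed_Iic.preimage hcont) : IsCompact (Set.Icc a b ∩ cdf μ ⁻¹' Set.Iic s)).exists_isGreatest
      ⟨a, ⟨le_rfl, hab⟩, hs⟩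
    have hy : cdf μ y = min s (cdf μ b) := by
      refine le_antisymm (le_min hyK.2 (hmono hyK.1.2)) ?_
      by_contra! hlt
      obtain ⟨x, hx, hxe⟩ := intermediate_value_Icc hyK.1.2 hcont.continuousOn
        ⟨hlt.le, min_le_right _ _⟩
      have := hmono (hyub ⟨⟨hyK.1.1.trans hx.1, hx.2⟩, hxe.trans_le (min_le_left _ _)⟩)
      linarith
    have hset : cdf μ ⁻¹' Set.Iic s ∩ Set.Ioc a b = Set.Ioc a y := by
      ext x
      constructor
      · exact fun h => ⟨h.2.1, hyub ⟨⟨h.2.1.le, h.2.2⟩, h.1⟩⟩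
      · exact fun h => ⟨(hmono h.2).trans hyK.2, h.1, h.2.trans hyK.1.2⟩
    rw [hset, measure_Ioc_eq_cdf_sub, hy]

theorem setIntegral_comp_cdf (μ : Measure ℝ) [IsProbabilityMeasure μ] [NullSingletonClass μ] {a b : ℝ}
    (hab : a ≤ b) {g : ℝ → ℝ} (hg : Continuous g) :
    ∫ x in Set.Ioc a b, g (cdf μ x) ∂μ = ∫ v in (cdf μ a)..(cdf μ b), g v := by
  rw [intervalIntegral.integral_of_le (monotone_cdf μ hab), ← map_cdf_restrict_Ioc μ hab,
    integral_map (monotone_cdf μ).measurable.aemeasurable hg.aestronglyMeasurable]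

/-! ### Recursion and measurability of the reward -/

theorem risingThresholdReward_zero_slots {n : ℕ} (τ : ℝ) (v : Fin n → ℝ) :
    risingThresholdReward 0 τ v = 0 := by
  simp [risingThresholdReward, acceptedValues]

theorem risingThresholdReward_no_values (k : ℕ) (τ : ℝ) (v : Fin 0 → ℝ) :
    risingThresholdReward k τ v = 0 := by
  cases k <;> simp [risingThresholdReward, acceptedValues]

theorem risingThresholdReward_cons (k : ℕ) (τ x : ℝ) {n : ℕ} (v : Fin n → ℝ) :
    risingThresholdReward (k + 1) τ (Fin.cons x v : Fin (n + 1) → ℝ) =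
      if τ < x then max x (risingThresholdReward k x v)
      else risingThresholdReward (k + 1) τ v := by
  unfold risingThresholdReward
  rw [List.ofFn_cons, acceptedValues]
  split_ifs <;> simp

theorem risingThresholdReward_nonneg (k : ℕ) (τ : ℝ) {n : ℕ} (v : Fin n → ℝ) :
    0 ≤ risingThresholdReward k τ v := by
  unfold risingThresholdReward
  induction acceptedValues k τ (List.ofFn v) with
  | nil => simp
  | cons x l ih => exact le_max_of_le_right ih

theorem measurable_risingThresholdReward (n k : ℕ) :
    Measurable fun p : ℝ × (Fin n → ℝ) => risingThresholdReward k p.1 p.2 := by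
  induction n generalizing k with
  | zero => simp only [risingThresholdReward_no_values]; exact measurable_const
  | succ n ih =>
    cases k with
    | zero => simp only [risingThresholdReward_zero_slots]; exact measurable_const
    | succ k =>
      have h : (fun p : ℝ × (Fin (n + 1) → ℝ) => risingThresholdReward (k + 1) p.1 p.2) =
          fun p => if p.1 < p.2 0 then max (p.2 0) (risingThresholdReward k (p.2 0) (Fin.tail p.2))
            else risingThresholdReward (k + 1) p.1 (Fin.tail p.2) := by
        funext p
        rw [← risingThresholdReward_cons, Fin.cons_self_tail]
      have htail : Measurable fun p : ℝ × (Fin (n + 1) → ℝ) => Fin.tail p.2 :=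
        measurable_pi_lambda _ fun i => (measurable_pi_apply i.succ).comp measurable_snd
      have h0 : Measurable fun p : ℝ × (Fin (n + 1) → ℝ) => p.2 0 :=
        (measurable_pi_apply 0).comp measurable_snd
      rw [h]
      exact Measurable.ite (measurableSet_lt measurable_fst h0)
        (h0.max ((ih k).comp (h0.prodMk htail))) ((ih (k + 1)).comp (measurable_fst.prodMk htail))

/-! ### Probability of missing a level -/

/-- The rule with `k` slots and threshold `τ` misses the level `t` on `v`: some value exceeds `t`,
but the reward does not. -/
def missSet (n k : ℕ) (t τ : ℝ) : Set (Fin n → ℝ) :=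
  {v | risingThresholdReward k τ v ≤ t ∧ ∃ i, t < v i}

theorem measurableSet_exists_lt (n : ℕ) (t : ℝ) : MeasurableSet {v : Fin n → ℝ | ∃ i, t < v i} := by
  simp only [Set.ofPred_exists]
  exact MeasurableSet.iUnion fun i => measurableSet_lt measurable_const (measurable_pi_apply i)

theorem measurableSet_prod_missSet (n k : ℕ) (t : ℝ) :
    MeasurableSet {p : ℝ × (Fin n → ℝ) | p.2 ∈ missSet n k t p.1} :=
  (measurableSet_le (measurable_risingThresholdReward n k) measurable_const).inter
    ((measurableSet_exists_lt n t).preimage measurable_snd)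

theorem measurableSet_missSet (n k : ℕ) (t τ : ℝ) : MeasurableSet (missSet n k t τ) :=
  (measurableSet_prod_missSet n k t).preimage measurable_prodMk_left

theorem cons_mem_missSet {n k : ℕ} {t τ x : ℝ} (hτ : τ ≤ t) {v : Fin n → ℝ} :
    (Fin.cons x v : Fin (n + 1) → ℝ) ∈ missSet (n + 1) (k + 1) t τ ↔
      (x ≤ τ ∧ v ∈ missSet n (k + 1) t τ) ∨ (x ∈ Set.Ioc τ t ∧ v ∈ missSet n k t x) := by
  simp only [missSet, Set.mem_ofPred_eq, risingThresholdReward_cons, Fin.exists_fin_succ,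
    Fin.cons_zero, Fin.cons_succ, Set.mem_Ioc]
  by_cases h : τ < x
  · rw [if_pos h, max_le_iff]
    constructor
    · rintro ⟨⟨h1, h2⟩, h3 | h3⟩
      · exact absurd h3 h1.not_gt
      · exact Or.inr ⟨⟨h, h1⟩, h2, h3⟩
    · rintro (⟨h1, -⟩ | ⟨⟨-, h1⟩, h2, h3⟩)
      · exact absurd h h1.not_gt
      · exact ⟨⟨h1, h2⟩, Or.inr h3⟩
  · rw [if_neg h]
    have hxt : ¬ t < x := by linarith
    simp [h, hxt, not_lt.1 h]

theorem measurable_missProb (μ : Measure ℝ) [IsProbabilityMeasure μ] (n k : ℕ) (t : ℝ) :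
    Measurable fun x => (Measure.pi fun _ : Fin n => μ).real (missSet n k t x) :=
  (measurable_measure_prodMk_left (measurableSet_prod_missSet n k t)).ennreal_toReal

theorem integrable_missProb (μ : Measure ℝ) [IsProbabilityMeasure μ] (n k : ℕ) (t : ℝ) :
    Integrable (fun x => (Measure.pi fun _ : Fin n => μ).real (missSet n k t x)) μ :=
  Integrable.of_bound (measurable_missProb μ n k t).aestronglyMeasurable 1
    (Filter.Eventually.of_forall fun x => by
      rw [Real.norm_of_nonneg measureReal_nonneg]; exact measureReal_le_one)

theorem missProb_succ (μ : Measure ℝ) [IsProbabilityMeasure μ] (n k : ℕ) {t τ : ℝ} (hτ : τ ≤ t) :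
    (Measure.pi fun _ : Fin (n + 1) => μ).real (missSet (n + 1) (k + 1) t τ) =
      cdf μ τ * (Measure.pi fun _ : Fin n => μ).real (missSet n (k + 1) t τ) +
        ∫ x in Set.Ioc τ t, (Measure.pi fun _ : Fin n => μ).real (missSet n k t x) ∂μ := by
  set ν := Measure.pi fun _ : Fin n => μ
  have hmp := (measurePreserving_piFinSuccAbove (fun _ : Fin (n + 1) => μ) 0).symm
  have hS := measurableSet_missSet (n + 1) (k + 1) t τ
  have h1 : (Measure.pi fun _ : Fin (n + 1) => μ).real (missSet (n + 1) (k + 1) t τ) =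
      ∫ x, ν.real {v | (Fin.cons x v : Fin (n + 1) → ℝ) ∈ missSet (n + 1) (k + 1) t τ} ∂μ := by
    have hS' := hmp.measurable hS
    rw [measureReal_def, ← hmp.measure_preimage hS.nullMeasurableSet, Measure.prod_apply hS',
      ← integral_toReal (measurable_measure_prodMk_left hS').aemeasurable
        (Filter.Eventually.of_forall fun _ => measure_lt_top _ _)]
    refine integral_congr_ae (Filter.Eventually.of_forall fun x => ?_)
    simp only [measureReal_def]
    congr 2
    ext v
    simp [MeasurableEquiv.piFinSuccAbove, Fin.insertNthEquiv]
  have h2 : ∀ x, ν.real {v | (Fin.cons x v : Fin (n + 1) → ℝ) ∈ missSet (n + 1) (k + 1) t τ} =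
      (Set.Iic τ).indicator (fun _ => ν.real (missSet n (k + 1) t τ)) x +
        (Set.Ioc τ t).indicator (fun x => ν.real (missSet n k t x)) x := by
    intro x
    simp only [cons_mem_missSet hτ, Set.indicator_apply, Set.mem_Iic]
    by_cases h : x ≤ τ
    · have h' : x ∉ Set.Ioc τ t := fun hx => hx.1.not_ge h
      simp [h, h']
    · by_cases h' : x ∈ Set.Ioc τ t <;> simp [h, h']
  rw [h1]
  simp only [h2]
  rw [integral_add ((integrable_const _).indicator measurableSet_Iic)
      ((integrable_missProb μ n k t).indicator measurableSet_Ioc),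
    integral_indicator measurableSet_Iic, integral_indicator measurableSet_Ioc,
    setIntegral_const, ← cdf_eq_real, smul_eq_mul]

theorem pi_real_exists_lt (μ : Measure ℝ) [IsProbabilityMeasure μ] (n : ℕ) (t : ℝ) :
    (Measure.pi fun _ : Fin n => μ).real {v | ∃ i, t < v i} = 1 - cdf μ t ^ n := by
  have h : {v : Fin n → ℝ | ∃ i, t < v i} = (Set.univ.pi fun _ => Set.Iic t)ᶜ := by
    ext v; simp [Pi.le_def]
  rw [h, probReal_compl_eq_one_sub (MeasurableSet.univ_pi fun _ => measurableSet_Iic),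
    measureReal_def, Measure.pi_pi, ENNReal.toReal_prod, cdf_eq_real]
  simp [measureReal_def]

theorem missProb_le (μ : Measure ℝ) [IsProbabilityMeasure μ] (n k : ℕ) (t τ : ℝ) :
    (Measure.pi fun _ : Fin n => μ).real (missSet n k t τ) ≤ 1 - cdf μ t ^ n := by
  rw [← pi_real_exists_lt]
  exact measureReal_mono fun v hv => hv.2

/-- The left side is the expectation of a variable equal to `(r + 1) ^ k` on a miss and `1` on the
rest of `{max > t}`. Keeping both parts, rather than applying Markov's inequality, lets the final
bound carry the factor `P(max > t)`. -/
theorem missProb_le_recordEnvelope (μ : Measure ℝ) [IsProbabilityMeasure μ] [NullSingletonClass μ] {r : ℝ}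
    (hr : 1 ≤ r) (n k : ℕ) {t τ : ℝ} (hτ : τ ≤ t) :
    ((r + 1) ^ k - 1) * (Measure.pi fun _ : Fin n => μ).real (missSet n k t τ) + (1 - cdf μ t ^ n)
      ≤ recordEnvelope r (cdf μ t) n (cdf μ t - cdf μ τ) := by
  have hc0 := cdf_nonneg μ t
  have hc1 := cdf_le_one μ t
  induction n generalizing k τ with
  | zero => simp [missSet, recordEnvelope]
  | succ n ih =>
    have hu : 0 ≤ cdf μ t - cdf μ τ := sub_nonneg.2 (monotone_cdf μ hτ)
    cases k with
    | zero =>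
      simpa using one_sub_pow_le_recordEnvelope hr hc0 hc1 hu (n + 1)
    | succ k =>
      have hstep := recordEnvelope_step hr hc1 hu (sub_le_self _ (cdf_nonneg μ τ)) n
      have hcc : Continuous fun w => recordEnvelope r (cdf μ t) n (cdf μ t - w) :=
        (continuous_recordEnvelope hr _ n).comp (by fun_prop)
      have hsub : ∫ v in (0 : ℝ)..(cdf μ t - cdf μ τ), recordEnvelope r (cdf μ t) n v =
          ∫ x in Set.Ioc τ t, recordEnvelope r (cdf μ t) n (cdf μ t - cdf μ x) ∂μ := by
        rw [setIntegral_comp_cdf μ hτ hcc,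
          intervalIntegral.integral_comp_sub_left (fun v => recordEnvelope r (cdf μ t) n v), sub_self]
      set ν := Measure.pi fun _ : Fin n => μ
      have hI : Integrable (fun x => ν.real (missSet n k t x)) (μ.restrict (Set.Ioc τ t)) :=
        (integrable_missProb μ n k t).integrableOn
      have hreal : μ.real (Set.Ioc τ t) = cdf μ t - cdf μ τ := by
        rw [measureReal_def, measure_Ioc_eq_cdf_sub, ENNReal.toReal_ofReal hu]
      have hE : IntegrableOn (fun x => recordEnvelope r (cdf μ t) n (cdf μ t - cdf μ x))
          (Set.Ioc τ t) μ :=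
        ((hcc.comp (continuous_cdf μ)).continuousOn.integrableOn_Icc (a := τ) (b := t)).mono_set
          Set.Ioc_subset_Icc_self
      have hint : ((r + 1) ^ (k + 1) - 1) * ∫ x in Set.Ioc τ t, ν.real (missSet n k t x) ∂μ ≤
          (r + 1) * (∫ x in Set.Ioc τ t, recordEnvelope r (cdf μ t) n (cdf μ t - cdf μ x) ∂μ)
            - (cdf μ t - cdf μ τ) * (1 - cdf μ t ^ n) := by
        rw [← integral_const_mul, ← integral_const_mul, ← hreal, ← smul_eq_mul (μ.real _),
          ← setIntegral_const, ← integral_sub (hE.const_mul _) (integrable_const _)]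
        refine setIntegral_mono_on (hI.const_mul _) ((hE.const_mul _).sub (integrable_const _))
          measurableSet_Ioc fun x hx => ?_
        -- Scaling the hypothesis for `k` slots by `r + 1` leaves an excess of `r` times the miss
        -- probability, absorbed by `r (1 - F(t) ^ n)`.
        have h1 := mul_le_mul_of_nonneg_left (ih k hx.2) (by linarith : 0 ≤ r + 1)
        have h2 := mul_le_mul_of_nonneg_left (missProb_le μ n k t x) (by linarith : 0 ≤ r)
        rw [pow_succ]
        linarith
      have h0 := mul_le_mul_of_nonneg_left (ih (k + 1) hτ) (cdf_nonneg μ τ)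
      rw [missProb_succ μ n k hτ, pow_succ (cdf μ t)]
      rw [hsub, sub_sub_cancel] at hstep
      linarith

/-! ### Numerical estimates of the loss -/

theorem exp_neg_three_lt : Real.exp (-3) < 1 / 20 := by
  have h : (20 : ℝ) < Real.exp 3 := by
    have := Real.exp_one_gt_d9
    rw [show (3 : ℝ) = (3 : ℕ) * 1 by norm_num, Real.exp_nat_mul]
    calc (20 : ℝ) < 2.7182818283 ^ 3 := by norm_num
      _ < _ := by gcongr
  rw [Real.exp_neg, inv_eq_one_div]
  exact one_div_lt_one_div_of_lt (by norm_num) h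

theorem exp_le_of_exp_pow_le {x y a : ℝ} {m j : ℕ} (hm : m ≠ 0) (hy : 0 ≤ y) (hx : x ≤ a)
    (ha : m * a = j) (h : (2.7182818286 : ℝ) ^ j ≤ y ^ m) : Real.exp x ≤ y := by
  refine (Real.exp_le_exp.2 hx).trans ?_
  refine (pow_le_pow_iff_left₀ (Real.exp_pos _).le hy hm).1 (le_trans ?_ h)
  rw [← Real.exp_nat_mul, ha, ← mul_one (j : ℝ), Real.exp_nat_mul]
  have := Real.exp_one_lt_d9
  gcongr

/-- With `r = 1` the bracket is just `q / 2`. Here `y` is a rational bound for `q`, and a fifth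
power clears the exponent `-k / 5`. -/
theorem exists_loss_le_two_three {k : ℕ} {y : ℝ} (h2 : Real.sqrt 2 ≤ Real.sqrt k)
    (hq : Real.exp (Real.sqrt k) ≤ y)
    (h : (1 / 20 + y / 2 / (2 ^ k - 1)) ^ 5 * (k : ℝ) ^ k ≤ 1) :
    ∃ r : ℝ, 1 ≤ r ∧ Real.exp (-Real.exp (Real.sqrt k)) +
      (((1 + Real.exp (Real.sqrt k)) ^ (r + 1) - 1) / ((r + 1) * Real.exp (Real.sqrt k)) - 1) /
        ((r + 1) ^ k - 1) ≤ (k : ℝ) ^ (-(k : ℝ) / 5) := by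
  have hsq : Real.sqrt 2 ^ 2 = 2 := Real.sq_sqrt (by norm_num)
  have hs : 1 ≤ Real.sqrt 2 := by nlinarith [Real.sqrt_nonneg 2]
  have hq3 : 3 ≤ Real.exp (Real.sqrt k) := by
    have := Real.quadratic_le_exp_of_nonneg (Real.sqrt_nonneg k)
    nlinarith
  have hk : (0 : ℝ) < k := Real.sqrt_pos.1 (by linarith)
  have hk0 : k ≠ 0 := by rintro rfl; simp at hk
  set q := Real.exp (Real.sqrt k)
  have h2k : (0 : ℝ) < 2 ^ k - 1 := sub_pos.2 (one_lt_pow₀ one_lt_two hk0)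
  refine ⟨1, le_rfl, ?_⟩
  rw [one_add_one_eq_two, Real.rpow_two]
  have hB : ((1 + q) ^ 2 - 1) / (2 * q) - 1 = q / 2 := by field_simp; ring
  rw [hB]
  have he : Real.exp (-q) ≤ 1 / 20 :=
    (Real.exp_le_exp.2 (by linarith)).trans exp_neg_three_lt.le
  calc Real.exp (-q) + q / 2 / (2 ^ k - 1) ≤ 1 / 20 + y / 2 / (2 ^ k - 1) := by gcongr
    _ ≤ (k : ℝ) ^ (-(k : ℝ) / 5) := by
      refine (pow_le_pow_iff_left₀ (by have : 0 ≤ y := by linarith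
                                       positivity) (by positivity) (by norm_num : 5 ≠ 0)).1 ?_
      rw [← Real.rpow_natCast ((k : ℝ) ^ (-(k : ℝ) / 5)), ← Real.rpow_mul hk.le,
        show -(k : ℝ) / 5 * (5 : ℕ) = -(k : ℝ) by push_cast; ring, Real.rpow_neg hk.le,
        Real.rpow_natCast, ← one_div]
      exact (le_div_iff₀ (by positivity)).2 h

theorem log_lower_bound {s : ℝ} (hs : 2 ≤ s) : 1.693 - 2 / s ≤ Real.log s := by
  have h := Real.one_sub_inv_le_log_of_pos (x := s / 2) (by linarith)
  rw [Real.log_div (by linarith) two_ne_zero, inv_div] at h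
  linarith [Real.log_two_gt_d9]

theorem mul_exp_neg_le {s : ℝ} (hs : 2 ≤ s) : s * Real.exp (-s) ≤ 0.271 := by
  have h1 : s ≤ 2 * Real.exp (s - 2) := by linarith [Real.add_one_le_exp (s - 2)]
  have h2 : (7.388 : ℝ) ≤ Real.exp 2 := by
    rw [show (2 : ℝ) = (2 : ℕ) * 1 by norm_num, Real.exp_nat_mul]
    calc (7.388 : ℝ) ≤ 2.7182818283 ^ 2 := by norm_num
      _ ≤ _ := by gcongr; exact Real.exp_one_gt_d9.le
  rw [Real.exp_neg, ← div_eq_mul_inv, div_le_iff₀ (Real.exp_pos s)]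
  rw [Real.exp_sub, ← mul_div_assoc, le_div_iff₀ (Real.exp_pos 2)] at h1
  nlinarith

/-- With `s = √k` and `q = exp s`, this compares the exponent of the bound for `δ` with that of `k ^
(-k / 5) = exp (-0.4 s ^ 2 log s)`. The margin `0.07` leaves room for the `exp (-q)` term. -/
theorem exponent_bound {s : ℝ} (hs : 2 ≤ s) :
    s * (s + Real.exp (-s)) - Real.log s - s - s ^ 2 * Real.log s
      ≤ -0.07 - 0.4 * s ^ 2 * Real.log s := by
  have hlog := log_lower_bound hs
  have hs0 : 0 < s := by linarith
  have hexp : s * Real.exp (-s) ≤ 0.271 := mul_exp_neg_le hs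
  have h1 := mul_le_mul_of_nonneg_left hlog (by positivity : 0 ≤ 0.6 * s ^ 2 + 1)
  -- `0.341` is `0.271 + 0.07`: the bound on `s * exp (-s)` plus the margin.
  have h2 : s ^ 2 - s + 0.341 ≤ (0.6 * s ^ 2 + 1) * (1.693 - 2 / s) := by
    have h3 : (0.6 * s ^ 2 + 1) * (1.693 - 2 / s) - (s ^ 2 - s + 0.341) =
        (0.0158 * s ^ 3 - 0.2 * s ^ 2 + 1.352 * s - 2) / s := by
      field_simp; ring
    have h4 : 0 ≤ 0.0158 * s ^ 3 - 0.2 * s ^ 2 + 1.352 * s - 2 := by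
      nlinarith [mul_nonneg (sub_nonneg.2 hs) (sq_nonneg (s - 5.4))]
    have := div_nonneg h4 hs0.le
    linarith
  linarith

theorem exp_dominates {s : ℝ} (hs : 2 ≤ s) : 0.4 * s ^ 2 * Real.log s + 3 ≤ Real.exp s := by
  have h1 := Real.log_le_sub_one_of_pos (by linarith : 0 < s)
  have h2 : 1 + s + s ^ 2 / 2 + s ^ 3 / 6 + s ^ 4 / 24 ≤ Real.exp s := by
    have := Real.sum_le_exp_of_nonneg (by linarith : 0 ≤ s) 5
    simp only [Finset.sum_range_succ, Finset.sum_range_zero, Nat.factorial] at this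
    norm_num at this
    linarith
  have h3 := mul_le_mul_of_nonneg_left h1 (by positivity : 0 ≤ 0.4 * s ^ 2)
  have h4 : 0.4 * s ^ 2 * (s - 1) + 3 ≤ 1 + s + s ^ 2 / 2 + s ^ 3 / 6 + s ^ 4 / 24 := by
    nlinarith [mul_nonneg (sq_nonneg s) (sq_nonneg (s - 2.8)), sq_nonneg s]
  linarith

theorem exists_loss_le_of_four_le {k : ℕ} (hk : 4 ≤ k) :
    ∃ r : ℝ, 1 ≤ r ∧ Real.exp (-Real.exp (Real.sqrt k)) +
      (((1 + Real.exp (Real.sqrt k)) ^ (r + 1) - 1) / ((r + 1) * Real.exp (Real.sqrt k)) - 1) /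
        ((r + 1) ^ k - 1) ≤ (k : ℝ) ^ (-(k : ℝ) / 5) := by
  have hk' : (4 : ℝ) ≤ k := by exact_mod_cast hk
  have hs : 2 ≤ Real.sqrt k := Real.le_sqrt_of_sq_le (by linarith)
  have hsk : Real.sqrt k ^ 2 = k := Real.sq_sqrt (by positivity)
  set s := Real.sqrt k
  have hs0 : 0 < s := by linarith
  refine ⟨s - 1, by linarith, ?_⟩
  rw [sub_add_cancel]
  have hpow : s ^ k = Real.exp (s ^ 2 * Real.log s) := by
    rw [hsk, mul_comm, Real.exp_mul, Real.exp_log hs0, Real.rpow_natCast]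
  have hloss : (k : ℝ) ^ (-(k : ℝ) / 5) = Real.exp (-(0.4 * s ^ 2 * Real.log s)) := by
    rw [Real.rpow_def_of_pos (by linarith), ← hsk, Real.log_pow]
    congr 1; push_cast; ring
  set q := Real.exp s
  have hq : 0 < q := Real.exp_pos s
  have h1q : (1 + q) ^ s ≤ Real.exp (s * (s + Real.exp (-s))) := by
    have h : 1 + q ≤ Real.exp (s + Real.exp (-s)) := by
      rw [Real.exp_add]
      have := mul_le_mul_of_nonneg_left (Real.add_one_le_exp (Real.exp (-s))) hq.le
      rw [mul_add, ← Real.exp_add] at this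
      simp only [add_neg_cancel, Real.exp_zero] at this
      linarith
    rw [mul_comm, Real.exp_mul]
    exact Real.rpow_le_rpow (by positivity) h hs0.le
  -- The target loss is split: `0.95` of it for the record term, `0.05` for `exp (-q)`.
  have hD : (1 + q) ^ s / (s * q) / s ^ k ≤
      0.95 * Real.exp (-(0.4 * s ^ 2 * Real.log s)) := by
    calc (1 + q) ^ s / (s * q) / s ^ k
        ≤ Real.exp (s * (s + Real.exp (-s))) / (s * q) / s ^ k := by gcongr
      _ = Real.exp (s * (s + Real.exp (-s)) - Real.log s - s - s ^ 2 * Real.log s) := by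
        rw [Real.exp_sub, Real.exp_sub, Real.exp_sub, Real.exp_log hs0, ← hpow, ← div_div]
      _ ≤ Real.exp (-0.07 - 0.4 * s ^ 2 * Real.log s) := Real.exp_le_exp.2 (exponent_bound hs)
      _ = Real.exp (-0.07) * Real.exp (-(0.4 * s ^ 2 * Real.log s)) := by
        rw [← Real.exp_add, sub_eq_add_neg]
      _ ≤ _ := by
        gcongr
        have := Real.add_one_le_exp (0.07 : ℝ)
        rw [Real.exp_neg, inv_le_comm₀ (Real.exp_pos _) (by norm_num)]
        norm_num at this ⊢
        linarith
  have hlog : 0 ≤ Real.log s := Real.log_nonneg (by linarith)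
  have hE1 : Real.exp (-(0.4 * s ^ 2 * Real.log s)) ≤ 1 :=
    Real.exp_le_one_iff.2 (neg_nonpos.2 (by positivity))
  have hzero : Real.exp (-q) ≤ 0.05 * Real.exp (-(0.4 * s ^ 2 * Real.log s)) := by
    calc Real.exp (-q) ≤ Real.exp (-3 + -(0.4 * s ^ 2 * Real.log s)) :=
          Real.exp_le_exp.2 (by linarith [exp_dominates hs])
      _ ≤ _ := by
        rw [Real.exp_add]
        gcongr
        linarith [exp_neg_three_lt]
  have hsk1 : 1 < s ^ k := one_lt_pow₀ (by linarith) (by omega)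
  set D := (1 + q) ^ s / (s * q) / s ^ k with hDdef
  have hBD : ((1 + q) ^ s - 1) / (s * q) ≤ D * s ^ k := by
    rw [hDdef, div_mul_cancel₀ _ (by positivity)]
    gcongr
    linarith
  have hmain : (((1 + q) ^ s - 1) / (s * q) - 1) / (s ^ k - 1) ≤ D := by
    rw [div_le_iff₀ (by linarith)]
    nlinarith
  rw [hloss]
  linarith

theorem exists_loss_le {k : ℕ} (hk : 2 ≤ k) :
    ∃ r : ℝ, 1 ≤ r ∧ Real.exp (-Real.exp (Real.sqrt k)) +
      (((1 + Real.exp (Real.sqrt k)) ^ (r + 1) - 1) / ((r + 1) * Real.exp (Real.sqrt k)) - 1) /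
        ((r + 1) ^ k - 1) ≤ (k : ℝ) ^ (-(k : ℝ) / 5) := by
  rcases le_or_gt 4 k with h | h
  · exact exists_loss_le_of_four_le h
  have hs : Real.sqrt 2 ≤ Real.sqrt k := Real.sqrt_le_sqrt (by exact_mod_cast hk)
  interval_cases k
  · refine exists_loss_le_two_three (y := 4.2) hs ?_ (by norm_num)
    exact exp_le_of_exp_pow_le (a := 17 / 12) (m := 12) (j := 17) (by norm_num) (by norm_num)
      (Real.sqrt_le_iff.2 (by norm_num)) (by norm_num) (by norm_num)
  · refine exists_loss_le_two_three (y := 5.8) hs ?_ (by norm_num)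
    exact exp_le_of_exp_pow_le (a := 7 / 4) (m := 4) (j := 7) (by norm_num) (by norm_num)
      (Real.sqrt_le_iff.2 (by norm_num)) (by norm_num) (by norm_num)

theorem isLittleO_rpow_neg_self_exp (C : ℝ) :
    (fun k : ℕ => (k : ℝ) ^ (-(k : ℝ) / 5)) =o[Filter.atTop] (fun k : ℕ => Real.exp (-C * k)) := by
  have h : (fun k : ℕ => (k : ℝ) ^ (-(k : ℝ) / 5)) =ᶠ[Filter.atTop]
      fun k : ℕ => Real.exp (Real.log k * (-(k : ℝ) / 5)) := by
    filter_upwards [Filter.eventually_gt_atTop 0] with k hk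
    exact Real.rpow_def_of_pos (by exact_mod_cast hk) _
  refine h.trans_isLittleO (Real.isLittleO_exp_comp_exp_comp.2 ?_)
  have hlog : Filter.Tendsto (fun k : ℕ => Real.log k / 5 - C) Filter.atTop Filter.atTop :=
    Filter.tendsto_atTop_add_const_right _ _
      ((Real.tendsto_log_atTop.comp tendsto_natCast_atTop_atTop).atTop_div_const (by norm_num))
  refine (tendsto_natCast_atTop_atTop.atTop_mul_atTop₀ hlog).congr fun k => ?_
  ring

/-! ### Comparison of tails -/

theorem missProb_le_mul (μ : Measure ℝ) [IsProbabilityMeasure μ] [NullSingletonClass μ] {r : ℝ}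
    (hr : 1 ≤ r) {n k : ℕ} (hk : k ≠ 0) {t τ q : ℝ} (hτ : τ ≤ t) (hq : 0 < q)
    (hqτ : n * (1 - cdf μ τ) = q) :
    (Measure.pi fun _ : Fin n => μ).real (missSet n k t τ) ≤
      (1 - cdf μ t ^ n) *
        ((((1 + q) ^ (r + 1) - 1) / ((r + 1) * q) - 1) / ((r + 1) ^ k - 1)) := by
  have ha0 := cdf_nonneg μ τ
  have hc0 := cdf_nonneg μ t
  have hc1 := cdf_le_one μ t
  have hac := monotone_cdf μ hτ
  have hup : (cdf μ t - cdf μ τ) / cdf μ t ≤ 1 - cdf μ τ := by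
    rcases hc0.eq_or_lt with h | h
    -- If `F(t) = 0`, the quotient is `0` by convention.
    · rw [← h, div_zero]; linarith
    · rw [div_le_iff₀ h]; nlinarith
  have h1 := missProb_le_recordEnvelope μ hr n k hτ
  have h2 := recordEnvelope_le hr hc0 hc1 (sub_nonneg.2 hac) hup (n := n) (by rw [hqτ]; exact hq)
  rw [hqτ] at h2
  have hz : 1 < (r + 1) ^ k := one_lt_pow₀ (by linarith) hk
  rw [← mul_div_assoc, le_div_iff₀ (by linarith)]
  linarith

theorem risingThreshold_tail_bound (μ : Measure ℝ) [IsProbabilityMeasure μ]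
    [NullSingletonClass μ] {r : ℝ} (hr : 1 ≤ r) {n k : ℕ} (hk : k ≠ 0) {t τ q ε : ℝ} (hq : 0 < q)
    (hqτ : n * (1 - cdf μ τ) = q) (hε1 : ε ≤ 1)
    (hε : Real.exp (-q) + (((1 + q) ^ (r + 1) - 1) / ((r + 1) * q) - 1) / ((r + 1) ^ k - 1) ≤ ε) :
    (1 - ε) * (Measure.pi fun _ : Fin n => μ).real {v | ∃ i, t < v i} ≤
      (Measure.pi fun _ : Fin n => μ).real {v | t < risingThresholdReward k τ v} := by
  set ν := Measure.pi fun _ : Fin n => μ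
  set δ := (((1 + q) ^ (r + 1) - 1) / ((r + 1) * q) - 1) / ((r + 1) ^ k - 1)
  have hz : 1 < (r + 1) ^ k := one_lt_pow₀ (by linarith) hk
  have hδ0 : 0 ≤ δ := by
    have := one_add_mul_self_le_rpow_one_add (s := q) (by linarith) (by linarith : 1 ≤ r + 1)
    refine div_nonneg (sub_nonneg.2 ((one_le_div₀ (by positivity)).2 ?_)) (by linarith)
    linarith
  -- For `t < τ` the level is raised to `τ`, since a reward above `τ` is also above `t`.
  have hmiss := missProb_le_mul μ hr hk (le_max_right t τ) hq hqτ
  have hcover : 1 - cdf μ (max t τ) ^ n ≤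
      ν.real {v | t < risingThresholdReward k τ v} + ν.real (missSet n k (max t τ) τ) := by
    rw [← pi_real_exists_lt]
    refine (measureReal_mono fun v hv => ?_).trans (measureReal_union_le _ _)
    by_cases h : t < risingThresholdReward k τ v
    · exact Or.inl h
    · exact Or.inr ⟨(not_lt.1 h).trans (le_max_left _ _), hv⟩
  have hempty : cdf μ τ ^ n ≤ Real.exp (-q) := by
    have h1 : cdf μ τ ≤ Real.exp (-(1 - cdf μ τ)) := by
      linarith [Real.add_one_le_exp (-(1 - cdf μ τ))]
    calc cdf μ τ ^ n ≤ Real.exp (-(1 - cdf μ τ)) ^ n := pow_le_pow_left₀ (cdf_nonneg μ τ) h1 n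
      _ = Real.exp (-q) := by rw [← Real.exp_nat_mul, ← hqτ]; ring_nf
  have h0 : ∀ x, 0 ≤ 1 - cdf μ x ^ n := fun x =>
    sub_nonneg.2 (pow_le_one₀ (cdf_nonneg μ x) (cdf_le_one μ x))
  have h0' : ∀ x, 0 ≤ cdf μ x ^ n := fun x => pow_nonneg (cdf_nonneg μ x) n
  have hprod : (1 - cdf μ τ ^ n) * (1 - cdf μ t ^ n) ≤ 1 - cdf μ (max t τ) ^ n := by
    rcases max_cases t τ with ⟨h, -⟩ | ⟨h, -⟩ <;> rw [h]
    · exact mul_le_of_le_one_left (h0 t) (by linarith [h0' τ])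
    · exact mul_le_of_le_one_right (h0 τ) (by linarith [h0' t])
  rw [pi_real_exists_lt]
  have hexp := Real.exp_pos (-q)
  calc (1 - ε) * (1 - cdf μ t ^ n)
      ≤ (1 - δ) * (1 - cdf μ τ ^ n) * (1 - cdf μ t ^ n) := by
        refine mul_le_mul_of_nonneg_right ?_ (h0 t)
        nlinarith [mul_nonneg hδ0 (h0' τ)]
    _ = (1 - δ) * ((1 - cdf μ τ ^ n) * (1 - cdf μ t ^ n)) := by ring
    _ ≤ (1 - δ) * (1 - cdf μ (max t τ) ^ n) :=
        mul_le_mul_of_nonneg_left hprod (by linarith)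
    _ ≤ _ := by linarith

/-! ### Transfer to random variables and integration over levels -/

namespace IsIIDInstance

variable {Ω : Type*} [MeasurableSpace Ω] {P : Measure Ω} {n : ℕ} {X : Fin n → Ω → ℝ}

theorem nullSingletonClass_map (h : IsIIDInstance P X) (i : Fin n) :
    NullSingletonClass (P.map (X i)) :=
  ⟨fun x => by
    rw [Measure.map_apply (h.measurable i) (measurableSet_singleton x)]
    exact h.continuous i x⟩

variable [IsProbabilityMeasure P]

theorem map_eq_pi (h : IsIIDInstance P X) (i₀ : Fin n) :
    P.map (fun ω i => X i ω) = Measure.pi fun _ : Fin n => P.map (X i₀) := by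
  rw [(iIndepFun_iff_map_fun_eq_pi_map fun i => (h.measurable i).aemeasurable).1 h.indep]
  congr 1
  funext i
  exact (h.identDistrib i i₀).map_eq

theorem measureReal_le (h : IsIIDInstance P X) (i₀ i : Fin n) (τ : ℝ) :
    P.real {ω | τ ≤ X i ω} = 1 - cdf (P.map (X i₀)) τ := by
  have := h.nullSingletonClass_map i
  have : IsProbabilityMeasure (P.map (X i)) :=
    Measure.isProbabilityMeasure_map (h.measurable i).aemeasurable
  rw [← (h.identDistrib i i₀).map_eq, cdf_eq_real, ← probReal_compl_eq_one_sub measurableSet_Iic,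
    Set.compl_Iic, measureReal_congr Ioi_ae_eq_Ici,
    map_measureReal_apply (h.measurable i) measurableSet_Ici]
  rfl

theorem sum_measureReal_le (h : IsIIDInstance P X) (i₀ : Fin n) (τ : ℝ) :
    ∑ i, P.real {ω | τ ≤ X i ω} = n * (1 - cdf (P.map (X i₀)) τ) := by
  simp only [h.measureReal_le i₀, Finset.sum_const, Finset.card_univ, Fintype.card_fin,
    nsmul_eq_mul]

theorem exists_threshold (h : IsIIDInstance P X) {q : ℝ} (hq : 0 < q) (hqn : q ≤ n) :
    ∃ τ : ℝ, 0 ≤ τ ∧ ∑ i, P.real {ω | τ ≤ X i ω} = q := by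
  have hn : (0 : ℝ) < n := hq.trans_le hqn
  let i₀ : Fin n := ⟨0, by exact_mod_cast hn⟩
  have := h.nullSingletonClass_map i₀
  have : IsProbabilityMeasure (P.map (X i₀)) :=
    Measure.isProbabilityMeasure_map (h.measurable i₀).aemeasurable
  set F := cdf (P.map (X i₀))
  have hlt : 1 - q / n < 1 := by linarith [div_pos hq hn]
  have hF0 : F 0 = 0 := by
    have h1 : P.real {ω | 0 ≤ X i₀ ω} = 1 := by
      rw [measureReal_def, (prob_compl_eq_zero_iff
        (measurableSet_le measurable_const (h.measurable i₀))).1 (ae_iff.1 (h.nonneg i₀)),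
        ENNReal.toReal_one]
    linarith [h.measureReal_le i₀ i₀ 0]
  obtain ⟨b, hb0, hb⟩ := (((tendsto_cdf_atTop (P.map (X i₀))).eventually (lt_mem_nhds hlt)).and
    (Filter.eventually_ge_atTop 0)).exists.imp fun b hb => hb.symm
  obtain ⟨τ, hτ, hFτ⟩ := intermediate_value_Icc hb0 (continuous_cdf (P.map (X i₀))).continuousOn
    (⟨by rw [hF0]; exact sub_nonneg.2 ((div_le_one hn).2 hqn), hb.le⟩ :
      1 - q / n ∈ Set.Icc (F 0) (F b))
  refine ⟨τ, hτ.1, ?_⟩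
  rw [h.sum_measureReal_le i₀, hFτ]
  field_simp
  ring

theorem lintegral_reward_ge (h : IsIIDInstance P X) {r : ℝ} (hr : 1 ≤ r) {k : ℕ} (hk : k ≠ 0)
    {τ q ε : ℝ} (hq : 0 < q) (hqτ : ∑ i, P.real {ω | τ ≤ X i ω} = q) (hε1 : ε ≤ 1)
    (hε : Real.exp (-q) + (((1 + q) ^ (r + 1) - 1) / ((r + 1) * q) - 1) / ((r + 1) ^ k - 1) ≤ ε) :
    ENNReal.ofReal (1 - ε) * ∫⁻ ω, ENNReal.ofReal (⨆ i, X i ω) ∂P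
      ≤ ∫⁻ ω, ENNReal.ofReal (risingThresholdReward k τ (fun i => X i ω)) ∂P := by
  have hn : 0 < n := by
    rcases Nat.eq_zero_or_pos n with rfl | hn
    · simp at hqτ; linarith
    · exact hn
  let i₀ : Fin n := ⟨0, hn⟩
  have : Nonempty (Fin n) := ⟨i₀⟩
  have := h.nullSingletonClass_map i₀
  have : IsProbabilityMeasure (P.map (X i₀)) :=
    Measure.isProbabilityMeasure_map (h.measurable i₀).aemeasurable
  have hV : Measurable fun ω i => X i ω := measurable_pi_lambda _ h.measurable
  have hR : Measurable fun v : Fin n → ℝ => risingThresholdReward k τ v :=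
    (measurable_risingThresholdReward n k).comp measurable_prodMk_left
  have hbdd : ∀ ω, BddAbove (Set.range fun i => X i ω) := fun ω => Set.finite_range _ |>.bddAbove
  rw [lintegral_eq_lintegral_meas_lt P
      ((h.nonneg i₀).mono fun ω hω => hω.trans (le_ciSup (hbdd ω) i₀))
      (Measurable.iSup h.measurable).aemeasurable,
    lintegral_eq_lintegral_meas_lt P
      (Filter.Eventually.of_forall fun ω => risingThresholdReward_nonneg k τ _)
      (hR.comp hV).aemeasurable,
    ← lintegral_const_mul' _ _ ENNReal.ofReal_ne_top]
  refine lintegral_mono fun t => ?_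
  have htail := risingThreshold_tail_bound (P.map (X i₀)) hr hk (t := t) hq
    ((h.sum_measureReal_le i₀ τ).symm.trans hqτ) hε1 hε
  rw [← h.map_eq_pi i₀, map_measureReal_apply hV (measurableSet_exists_lt n t),
    map_measureReal_apply hV (measurableSet_lt measurable_const hR)] at htail
  have hsup : {ω | t < ⨆ i, X i ω} = (fun ω i => X i ω) ⁻¹' {v | ∃ i, t < v i} := by
    ext ω
    exact lt_ciSup_iff (hbdd ω)
  dsimp only
  rw [hsup, ← ofReal_measureReal (μ := P), ← ENNReal.ofReal_mul (by linarith),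
    ← ofReal_measureReal (μ := P)]
  exact ENNReal.ofReal_le_ofReal htail

end IsIIDInstance

theorem mainTheorem6 :
    (∀ (k : ℕ), 1 ≤ k →
      ∀ (Ω : Type*) [MeasurableSpace Ω] (P : Measure Ω) [IsProbabilityMeasure P]
        (n : ℕ) (X : Fin n → Ω → ℝ), IsIIDInstance P X →
        -- an initial threshold with expected count `e ^ √k` can be chosen (if `n` is large enough)
        (Real.exp (Real.sqrt k) ≤ n →
          ∃ τ : ℝ, 0 ≤ τ ∧ ∑ i, P.real {ω | τ ≤ X i ω} = Real.exp (Real.sqrt k)) ∧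
        -- every such choice gives competitive ratio at least `1 - k ^ (-k / 5)`
        (∀ τ : ℝ, ∑ i, P.real {ω | τ ≤ X i ω} = Real.exp (Real.sqrt k) →
          ENNReal.ofReal (1 - (k : ℝ) ^ (-(k : ℝ) / 5)) *
              ∫⁻ ω, ENNReal.ofReal (⨆ i, X i ω) ∂P
            ≤ ∫⁻ ω, ENNReal.ofReal (risingThresholdReward k τ (fun i => X i ω)) ∂P)) ∧
    -- the loss is super-exponentially small in `k`
    (∀ C : ℝ, (fun k : ℕ => (k : ℝ) ^ (-(k : ℝ) / 5)) =o[Filter.atTop]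
      (fun k : ℕ => Real.exp (-C * k))) := by
  refine ⟨fun k hk Ω _ P _ n X h => ⟨fun hn => h.exists_threshold (Real.exp_pos _) hn,
    fun τ hτ => ?_⟩, isLittleO_rpow_neg_self_exp⟩
  rcases hk.eq_or_lt with rfl | hk
  -- For `k = 1` the claimed ratio is `0`.
  · simp
  · obtain ⟨r, hr, hloss⟩ := exists_loss_le hk
    refine h.lintegral_reward_ge hr (by omega) (Real.exp_pos _) hτ ?_ hloss
    exact Real.rpow_le_one_of_one_le_of_nonpos (by exact_mod_cast hk.le)
      (by have : (0 : ℝ) ≤ k := Nat.cast_nonneg k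
          linarith)
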